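/- **Setting.** Let $Y^*$, $D^*$ be real random variables and $Z$ a $\{0,1\}$-valued random variable on a probability space. We observe $Z$, $D=1(D^*\le 0)$, and $Y=Y^*$ when $D=1$; when $D=0$ the outcome is missing and is recorded as $Y=-\infty$. Let $F_{Y,D|Z}(y,d\mid z)=\Pr(Y\le y,\,D\le d\mid Z=z)$, so that $F_{Y,D|Z}(y,1\mid z)=\Pr(Y^*\le y,\,D=1\mid Z=z)+\Pr(D=0\mid Z=z)$. Let $\Phi$ be the standard normal CDF and, for $\rho\in[-1,1]$, let $\Phi_2(\cdot,\cdot;\rho)$ be the joint CDF of two standard normal variables that are jointly normal (degenerate if $\rho=\pm1$) with correlation $\rho$. The local Gaussian representation (LGR) at $(y,0)$ of the joint distribution of $(Y^*,D^*)$ given $Z=z$ consists of $\mu(y\mid z)\in\mathbb R$, $\nu(z)\in\mathbb R$ and $\rho(y\mid z)\in[-1,1]$ with $$\Pr(Y^*\le y\mid Z=z)=\Phi(\mu(y\mid z)),\quad \Pr(D^*\le 0\mid Z=z)=\Phi(\nu(z)),\quad \Pr(Y^*\le y,\,D^*\le 0\mid Z=z)=\Phi_2(\mu(y\mid z),\nu(z);\rho(y\mid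 z)).$$ **Assumption (exclusion restrictions at $y$).** Fix $y\in\mathbb R$ with $0<\Pr(Y^*\le y\mid Z=z)<1$ for $z\in\{0,1\}$. (1) Non-degeneracy: $0<\Pr(D=1)<1$ and $0<\Pr(Z=1\mid D=1)<1$. (2) Relevance: $\Pr(D=1\mid Z=0)<\Pr(D=1\mid Z=1)<1$. (3) Outcome exclusion: $\mu(y\mid 0)=\mu(y\mid 1)=:\mu(y)$. (4) Selection exclusion: $\rho(y\mid 0)=\rho(y\mid 1)=:\rho(y)$. The identified set of $(\mu(y),\rho(y))$ is the set of all values that this pair takes in latent models $(Y^*,D^*,Z)$ that satisfy the assumption at $y$ and generate the given joint law of the observables $(Y,D,Z)$. **Theorem.** Under the assumption, $\nu(z)=\Phi^{-1}(\Pr(D=1\mid Z=z))$ for $z\in\{0,1\}$. Moreover, writing $F_z=F_{Y,D|Z}(y,1\mid z)$ and $q_z=\Pr(D=0\mid Z=z)$: 1. If $F_1-q_1=F_0-q_0>0$, then $\rho(y)=1$ and $\mu(y)=\Phi^{-1}(F_1-q_1)$. 2. If $F_1<1$ and $F_0=1$, then $\rho(y)=1$ and $\mu(y)=\Phi^{-1}(F_1-q_1)$.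 3. If $F_1=F_0=1$, then $\rho(y)=1$ and $\mu(y)\in[\Phi^{-1}(\Pr(D=1\mid Z=1)),+\infty)$. 4. If $F_1>q_1$ and $F_0=q_0$, then $\rho(y)=-1$ and $\mu(y)=\Phi^{-1}(F_1)$. 5. If $F_1=F_0<1$, then $\rho(y)=-1$ and $\mu(y)=\Phi^{-1}(F_1)$. 6. If $F_z=q_z$ for both $z\in\{0,1\}$, then $\rho(y)=-1$ and $\mu(y)\in(-\infty,\Phi^{-1}(F_1)]$. 7. Otherwise, the system $$F_z-q_z=\Phi_2\bigl(\mu,\Phi^{-1}(\Pr(D=1\mid Z=z));\rho\bigr),\qquad z\in\{0,1\},$$ has exactly one solution $(\mu,\rho)\in\mathbb R\times[-1,1]$, this solution is $(\mu(y),\rho(y))$, and $\rho(y)\in(-1,1)$. In each case the stated set is the whole identified set: in cases 1, 2, 4, 5 and 7 the identified set of $(\mu(y),\rho(y))$ is the single point given, in case 3 it is $[\Phi^{-1}(\Pr(D=1\mid Z=1)),+\infty)\times\{1\}$, and in case 6 it is $(-\infty,\Phi^{-1}(F_1)]\times\{-1\}$. -/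

import Mathlib

open MeasureTheory ProbabilityTheory

namespace SampleSelection

/-- `Φ`, the standard normal CDF. -/
noncomputable def stdNormalCDF (x : ℝ) : ℝ :=
  cdf (gaussianReal 0 1) x

/-- `Φ⁻¹`, the inverse of the standard normal CDF (meaningful on `(0, 1)`, the range of `Φ`). -/
noncomputable def probit : ℝ → ℝ :=
  Function.invFun stdNormalCDF

/-- `Φ₂(x, y; ρ)`, the joint CDF at `(x, y)` of a standard bivariate normal vector with
correlation `ρ ∈ [-1, 1]` (the degenerate laws `ρ = 1` and `ρ = -1` are included). -/
noncomputable def stdBivariateNormalCDF (x y ρ : ℝ) : ℝ :=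
  (multivariateGaussian (0 : EuclideanSpace ℝ (Fin 2)) !![1, ρ; ρ, 1]).real
    {v | v 0 ≤ x ∧ v 1 ≤ y}

/-- `(μ, ν, ρ)` is the local Gaussian representation at `(y, d)` of the joint distribution of
`X` and `W` under `P`: the marginal CDFs are `F_X(y) = Φ(μ)` and `F_W(d) = Φ(ν)`, and
`F_{X,W}(y, d) = Φ₂(μ, ν; ρ)` with `ρ ∈ [-1, 1]`. -/
structure IsLGR {Ω : Type*} [MeasurableSpace Ω] (P : Measure Ω) (X W : Ω → ℝ)
    (y d μ ν ρ : ℝ) : Prop where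
  marginal_fst : P.real {ω | X ω ≤ y} = stdNormalCDF μ
  marginal_snd : P.real {ω | W ω ≤ d} = stdNormalCDF ν
  corr_mem : ρ ∈ Set.Icc (-1 : ℝ) 1
  joint : P.real {ω | X ω ≤ y ∧ W ω ≤ d} = stdBivariateNormalCDF μ ν ρ

/-- The selection indicator `D = 1(D* ≤ 0)`. -/
noncomputable def obsD {Ω : Type*} (Dstar : Ω → ℝ) (ω : Ω) : Fin 2 :=
  if Dstar ω ≤ 0 then 1 else 0

/-- The observed outcome: `Y = Y*` if `D = 1`. If `D = 0` the outcome is missing, which is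
recorded by the value `-∞`, so that `F_{Y,D}(y, d) = P(D = 0)` for `0 ≤ d < 1`. -/
noncomputable def obsY {Ω : Type*} (Ystar Dstar : Ω → ℝ) (ω : Ω) : EReal :=
  if Dstar ω ≤ 0 then (Ystar ω : EReal) else ⊥

/-- `P(· | Z = z)`. -/
noncomputable def condZ {Ω : Type*} [MeasurableSpace Ω] (P : Measure Ω) (Z : Ω → Fin 2)
    (z : Fin 2) : Measure Ω :=
  ProbabilityTheory.cond P (Z ⁻¹' {z})

/-- `P(D = d | Z = z)`. -/
noncomputable def probD {Ω : Type*} [MeasurableSpace Ω] (P : Measure Ω) (Dstar : Ω → ℝ)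
    (Z : Ω → Fin 2) (d z : Fin 2) : ℝ :=
  (condZ P Z z).real {ω | obsD Dstar ω = d}

/-- `F_{Y,D|Z}(y, d | z) = P(Y ≤ y, D ≤ d | Z = z)`, the conditional joint CDF of the observed
variables. -/
noncomputable def obsCDF {Ω : Type*} [MeasurableSpace Ω] (P : Measure Ω) (Ystar Dstar : Ω → ℝ)
    (Z : Ω → Fin 2) (y : ℝ) (d z : Fin 2) : ℝ :=
  (condZ P Z z).real {ω | obsY Ystar Dstar ω ≤ (y : EReal) ∧ obsD Dstar ω ≤ d}

/-- The joint law of the observables `(Y, D, Z)`. -/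
noncomputable def obsLaw {Ω : Type*} [MeasurableSpace Ω] (P : Measure Ω) (Ystar Dstar : Ω → ℝ)
    (Z : Ω → Fin 2) : Measure (EReal × Fin 2 × Fin 2) :=
  P.map (fun ω => (obsY Ystar Dstar ω, obsD Dstar ω, Z ω))

/-- The exclusion restrictions at the point `y`, where `μ = μ(y)`, `ρ = ρ(y) = ρ(y, 0)` and
`ν z = ν(z) = ν(0 | z)` are the parameters of the conditional local Gaussian representations. -/
structure ExclusionRestrictions {Ω : Type*} [MeasurableSpace Ω] (P : Measure Ω)
    (Ystar Dstar : Ω → ℝ) (Z : Ω → Fin 2) (y μ ρ : ℝ) (ν : Fin 2 → ℝ) : Prop where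
  /-- Non-degeneracy: `0 < P(D = 1) < 1`. -/
  selection_nondegenerate : P.real {ω | obsD Dstar ω = 1} ∈ Set.Ioo (0 : ℝ) 1
  /-- Non-degeneracy: `0 < P(Z = 1 | D = 1) < 1`. -/
  instrument_nondegenerate :
    (ProbabilityTheory.cond P {ω | obsD Dstar ω = 1}).real {ω | Z ω = 1} ∈ Set.Ioo (0 : ℝ) 1
  /-- Relevance: `P(D = 1 | Z = 0) < P(D = 1 | Z = 1)`. -/
  relevance : probD P Dstar Z 1 0 < probD P Dstar Z 1 1
  /-- Relevance, no identification at infinity: `P(D = 1 | Z = 1) < 1`. -/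
  relevance_lt_one : probD P Dstar Z 1 1 < 1
  /-- Outcome exclusion `μ(y | z) = μ(y)` and selection exclusion `ρ(y, 0 | z) = ρ(y, 0)`:
  the local Gaussian representation at `(y, 0)` of `F_{Y*,D*|Z}(·, · | z)` has the same first
  parameter and the same correlation for both values of `z`. -/
  exclusion : ∀ z, IsLGR (condZ P Z z) Ystar Dstar y 0 μ (ν z) ρ

/-- The identified set of `(μ(y), ρ(y))` given the law `L` of the observables: all values of
`(μ(y), ρ(y))` in latent models `(Y*, D*, Z)` that satisfy the exclusion restrictions at `y` and
generate `L`. A latent model is represented by its law on `ℝ × ℝ × {0, 1}`. -/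
def identifiedSet (L : Measure (EReal × Fin 2 × Fin 2)) (y : ℝ) : Set (ℝ × ℝ) :=
  {θ | ∃ Q : Measure (ℝ × ℝ × Fin 2), IsProbabilityMeasure Q ∧
    (∃ ν : Fin 2 → ℝ, ExclusionRestrictions Q (fun q => q.1) (fun q => q.2.1) (fun q => q.2.2)
      y θ.1 θ.2 ν) ∧
    obsLaw Q (fun q => q.1) (fun q => q.2.1) (fun q => q.2.2) = L}

/-- The solutions `(μ, ρ) ∈ ℝ × [-1, 1]` of the system
`F_{Y,D|Z}(y, 1 | z) - P(D = 0 | Z = z) = Φ₂(μ, Φ⁻¹(P(D = 1 | Z = z)); ρ)`, `z ∈ {0, 1}`. -/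
def solutionSet {Ω : Type*} [MeasurableSpace Ω] (P : Measure Ω) (Ystar Dstar : Ω → ℝ)
    (Z : Ω → Fin 2) (y : ℝ) : Set (ℝ × ℝ) :=
  {θ | θ.2 ∈ Set.Icc (-1 : ℝ) 1 ∧ ∀ z : Fin 2,
    obsCDF P Ystar Dstar Z y 1 z - probD P Dstar Z 0 z =
      stdBivariateNormalCDF θ.1 (probit (probD P Dstar Z 1 z)) θ.2}

end SampleSelection

/-!
Two facts carry the theorem.

*The identified set is the solution set of the system*
(`ExclusionRestrictions.identifiedSet_eq_solutionSet`). The exclusion restrictions say that `(μ, ρ)`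
solves `F z - q z = Φ₂(μ, ν z; ρ)`, where `ν z = Φ⁻¹(p z)`, and `F`, `p`, `q` depend on the law of
the observables only. Conversely, given a solution `(μ, ρ)`, the outcome on the unselected event
`D* > 0` is free: redrawing it there with an independent randomization (`redrawnLaw`) keeps the law
of the observables and gives `P(Y* ≤ y | Z = z)` any value between `F z - q z` and `F z`. By the
Fréchet bounds on `Φ₂` (`stdNormalCDF_mem_Icc`) the value `Φ(μ)` lies in this range.

*Two values of `Φ₂(μ, ·; ρ)` determine `(μ, ρ)` when `|ρ| < 1`*
(`eq_of_stdBivariateNormalCDF_eq`). Conditioning on the second coordinate `W` gives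
`Φ₂(μ, ν; ρ) = ∫_{t ≤ ν} Φ((μ - ρ t) / √(1 - ρ²)) dγ(t)`. The slope `ρ / √(1 - ρ²)` is increasing
in `ρ`, so for two different correlations the integrands cross exactly once. If the integrals over
`t ≤ ν 0` agree, the crossing occurs before `ν 0`; then the integrands are strictly ordered on
`(ν 0, ν 1]`, and the integrals over `t ≤ ν 1` differ. For equal correlations `Φ₂` is strictly
increasing in `μ`.

The cases of the theorem are then sorted by `stdBivariateNormalCDF_trichotomy`: for `|ρ| < 1` the
inequalities `0 < Φ₂(μ, ν 0; ρ) < p 0` and `0 < Φ₂(μ, ν 1; ρ) - Φ₂(μ, ν 0; ρ) < p 1 - p 0` are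
strict, which excludes the boundary cases; for `ρ = 1` and `ρ = -1`, `Φ₂` is the upper or lower Fréchet bound, an explicit function of
`Φ(μ)` and `p z`, and the system is solved by comparing `Φ(μ)` with `p z` or `q z`.
-/

namespace SampleSelection

/-! ### The standard normal distribution function -/

lemma nullSingletonClass_gaussianReal_zero_one : NullSingletonClass (gaussianReal 0 1) :=
  nullSingletonClass_gaussianReal one_ne_zero

lemma stdNormalCDF_eq_real (x : ℝ) : stdNormalCDF x = (gaussianReal 0 1).real (Set.Iic x) :=
  cdf_eq_real _ x

lemma stdNormalCDF_sub_eq_real {x y : ℝ} (h : x ≤ y) :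
    stdNormalCDF y - stdNormalCDF x = (gaussianReal 0 1).real (Set.Ioc x y) := by
  rw [stdNormalCDF_eq_real, stdNormalCDF_eq_real, ← Set.Iic_union_Ioc_eq_Iic h,
    measureReal_union (Set.Iic_disjoint_Ioc le_rfl) measurableSet_Ioc, add_sub_cancel_left]

lemma gaussianReal_ne_zero_of_Ioc_subset {x y : ℝ} (h : x < y) {s : Set ℝ}
    (hs : Set.Ioc x y ⊆ s) : gaussianReal 0 1 s ≠ 0 := fun h0 => by
  have := gaussianReal_absolutelyContinuous' 0 one_ne_zero (measure_mono_null hs h0)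
  exact h.not_ge (by simpa using this)

lemma stdNormalCDF_strictMono : StrictMono stdNormalCDF := fun x y h => by
  rw [← sub_pos, stdNormalCDF_sub_eq_real h.le]
  exact ENNReal.toReal_pos (gaussianReal_ne_zero_of_Ioc_subset h subset_rfl) (measure_ne_top _ _)

lemma measurable_stdNormalCDF : Measurable stdNormalCDF :=
  stdNormalCDF_strictMono.monotone.measurable

lemma stdNormalCDF_pos (x : ℝ) : 0 < stdNormalCDF x :=
  (cdf_nonneg _ (x - 1)).trans_lt (stdNormalCDF_strictMono (sub_one_lt x))

lemma stdNormalCDF_lt_one (x : ℝ) : stdNormalCDF x < 1 :=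
  (stdNormalCDF_strictMono (lt_add_one x)).trans_le (cdf_le_one _ _)

lemma stdNormalCDF_neg (x : ℝ) : stdNormalCDF (-x) = 1 - stdNormalCDF x := by
  have := nullSingletonClass_gaussianReal_zero_one
  have h : (gaussianReal 0 1).map (fun t => -t) = gaussianReal 0 1 := by
    rw [gaussianReal_map_neg, neg_zero]
  rw [stdNormalCDF_eq_real, stdNormalCDF_eq_real, ← probReal_compl_eq_one_sub measurableSet_Iic,
    Set.compl_Iic]
  conv_lhs => rw [← h]
  rw [map_measureReal_apply measurable_neg measurableSet_Iic]
  simp only [Set.neg_preimage, Set.neg_Iic, neg_neg]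
  exact measureReal_congr Ioi_ae_eq_Ici.symm

lemma probit_stdNormalCDF (x : ℝ) : probit (stdNormalCDF x) = x :=
  Function.leftInverse_invFun stdNormalCDF_strictMono.injective x

/-! ### The bivariate normal distribution function -/

lemma posSemidef_corr {ρ : ℝ} (hρ : ρ ∈ Set.Icc (-1 : ℝ) 1) :
    (!![1, ρ; ρ, 1] : Matrix (Fin 2) (Fin 2) ℝ).PosSemidef := by
  refine Matrix.PosSemidef.of_dotProduct_mulVec_nonneg ?_ fun x => ?_
  · ext i j
    fin_cases i <;> fin_cases j <;> simp
  · simp only [dotProduct, Matrix.mulVec, Fin.sum_univ_two, Matrix.of_apply, Matrix.cons_val',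
      Matrix.cons_val_zero, Matrix.cons_val_one, Matrix.cons_val_fin_one, star_trivial, Pi.star_apply]
    nlinarith [sq_nonneg (x 0 + ρ * x 1), sq_nonneg (x 1), hρ.1, hρ.2,
      mul_nonneg (sub_nonneg.2 hρ.2) (neg_le_iff_add_nonneg.1 hρ.1),
      mul_nonneg (mul_nonneg (sub_nonneg.2 hρ.2) (neg_le_iff_add_nonneg.1 hρ.1)) (sq_nonneg (x 1))]

lemma measurable_correlatedPair (ρ : ℝ) :
    Measurable (fun p : ℝ × ℝ => !₂[ρ * p.1 + √(1 - ρ ^ 2) * p.2, p.1]) := by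
  refine (PiLp.continuous_toLp 2 _).measurable.comp (measurable_pi_iff.2 fun i => ?_)
  fin_cases i
  · simp; fun_prop
  · simp; fun_prop

/-- If `W` and `E` are independent standard normal variables, then `(ρ W + √(1 - ρ²) E, W)` is
standard bivariate normal with correlation `ρ`. -/
lemma multivariateGaussian_eq_map {ρ : ℝ} (hρ : ρ ∈ Set.Icc (-1 : ℝ) 1) :
    multivariateGaussian (0 : EuclideanSpace ℝ (Fin 2)) !![1, ρ; ρ, 1] =
      ((gaussianReal 0 1).prod (gaussianReal 0 1)).map
        (fun p => !₂[ρ * p.1 + √(1 - ρ ^ 2) * p.2, p.1]) := by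
  have hm := measurable_correlatedPair ρ
  have := Measure.isProbabilityMeasure_map (μ := (gaussianReal 0 1).prod (gaussianReal 0 1))
    hm.aemeasurable
  refine Measure.ext_of_charFun (funext fun t => ?_)
  rw [charFun_multivariateGaussian (posSemidef_corr hρ), charFun_apply, integral_map hm.aemeasurable
    (Measurable.aestronglyMeasurable (by fun_prop))]
  have hs : (√(1 - ρ ^ 2)) ^ 2 = 1 - ρ ^ 2 := Real.sq_sqrt (by nlinarith [hρ.1, hρ.2])
  have h1 : ∀ p : ℝ × ℝ,
      Complex.exp ((inner ℝ (!₂[ρ * p.1 + √(1 - ρ ^ 2) * p.2, p.1] : EuclideanSpace ℝ (Fin 2)) t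
        : ℝ) * Complex.I) =
      Complex.exp ((t 0 * ρ + t 1 : ℝ) * (p.1 : ℝ) * Complex.I) *
        Complex.exp ((t 0 * √(1 - ρ ^ 2) : ℝ) * (p.2 : ℝ) * Complex.I) := fun p => by
    rw [← Complex.exp_add]
    congr 1
    simp [PiLp.inner_apply, Fin.sum_univ_two]
    ring
  simp_rw [h1]
  rw [integral_prod_mul (fun x : ℝ => Complex.exp ((t 0 * ρ + t 1 : ℝ) * (x : ℝ) * Complex.I))
    (fun x : ℝ => Complex.exp ((t 0 * √(1 - ρ ^ 2) : ℝ) * (x : ℝ) * Complex.I)),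
    ← charFun_apply_real, ← charFun_apply_real, charFun_gaussianReal, charFun_gaussianReal,
    ← Complex.exp_add]
  congr 1
  have hs' : ((√(1 - ρ ^ 2) : ℝ) : ℂ) ^ 2 = 1 - (ρ : ℂ) ^ 2 := by exact_mod_cast hs
  simp [dotProduct, Matrix.mulVec, Fin.sum_univ_two, mul_pow, hs']
  ring

lemma stdBivariateNormalCDF_eq_prod {ρ : ℝ} (hρ : ρ ∈ Set.Icc (-1 : ℝ) 1) (x y : ℝ) :
    stdBivariateNormalCDF x y ρ = ((gaussianReal 0 1).prod (gaussianReal 0 1)).real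
      {p | ρ * p.1 + √(1 - ρ ^ 2) * p.2 ≤ x ∧ p.1 ≤ y} := by
  have hm := measurable_correlatedPair ρ
  rw [stdBivariateNormalCDF, multivariateGaussian_eq_map hρ, map_measureReal_apply hm]
  · simp
  · exact MeasurableSet.inter (s₁ := {v : EuclideanSpace ℝ (Fin 2) | v 0 ≤ x})
      (s₂ := {v | v 1 ≤ y})
      (measurableSet_le (by fun_prop) measurable_const)
      (measurableSet_le (by fun_prop) measurable_const)

lemma stdBivariateNormalCDF_one (x y : ℝ) :
    stdBivariateNormalCDF x y 1 = stdNormalCDF (min x y) := by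
  rw [stdBivariateNormalCDF_eq_prod (by norm_num), stdNormalCDF_eq_real]
  have : {p : ℝ × ℝ | 1 * p.1 + √(1 - 1 ^ 2) * p.2 ≤ x ∧ p.1 ≤ y} =
      Set.Iic (min x y) ×ˢ Set.univ := by
    ext p; simp
  rw [this, measureReal_prod_prod, probReal_univ, mul_one]

lemma stdBivariateNormalCDF_neg_one (x y : ℝ) :
    stdBivariateNormalCDF x y (-1) = max (stdNormalCDF x + stdNormalCDF y - 1) 0 := by
  have := nullSingletonClass_gaussianReal_zero_one
  rw [stdBivariateNormalCDF_eq_prod (by norm_num)]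
  have : {p : ℝ × ℝ | -1 * p.1 + √(1 - (-1) ^ 2) * p.2 ≤ x ∧ p.1 ≤ y} =
      Set.Icc (-x) y ×ˢ Set.univ := by
    ext p; simp [neg_le]
  rw [this, measureReal_prod_prod, probReal_univ, mul_one, measureReal_congr Ioc_ae_eq_Icc.symm]
  have hx := stdNormalCDF_neg x
  rcases le_total (-x) y with h | h
  · rw [← stdNormalCDF_sub_eq_real h, max_eq_left]
    · linarith
    · linarith [stdNormalCDF_strictMono.monotone h]
  · rw [Set.Ioc_eq_empty h.not_gt, max_eq_right]
    · simp
    · linarith [stdNormalCDF_strictMono.monotone h]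

/-- For `|ρ| < 1`, disintegration along the second coordinate: given `W = t`, the first coordinate
is normal with mean `ρ t` and variance `1 - ρ²`. -/
lemma stdBivariateNormalCDF_eq_integral {ρ : ℝ} (hρ : ρ ∈ Set.Ioo (-1 : ℝ) 1) (x y : ℝ) :
    stdBivariateNormalCDF x y ρ = ∫ t in Set.Iic y,
      stdNormalCDF ((x - ρ * t) / √(1 - ρ ^ 2)) ∂(gaussianReal 0 1) := by
  have hs : 0 < √(1 - ρ ^ 2) := Real.sqrt_pos.2 (by nlinarith [hρ.1, hρ.2])
  have hS : MeasurableSet {p : ℝ × ℝ | ρ * p.1 + √(1 - ρ ^ 2) * p.2 ≤ x ∧ p.1 ≤ y} :=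
    MeasurableSet.inter (s₁ := {p : ℝ × ℝ | ρ * p.1 + √(1 - ρ ^ 2) * p.2 ≤ x})
      (s₂ := {p : ℝ × ℝ | p.1 ≤ y}) (measurableSet_le (by fun_prop) measurable_const)
      (measurableSet_le (by fun_prop) measurable_const)
  rw [stdBivariateNormalCDF_eq_prod (Set.Ioo_subset_Icc_self hρ), measureReal_def,
    Measure.prod_apply hS, ← integral_toReal (measurable_measure_prodMk_left hS).aemeasurable
      (by simp), ← integral_indicator measurableSet_Iic]
  refine integral_congr_ae (Filter.Eventually.of_forall fun t => ?_)
  dsimp only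
  by_cases ht : t ≤ y
  · rw [Set.indicator_of_mem (Set.mem_Iic.2 ht), stdNormalCDF_eq_real, measureReal_def]
    congr 2
    ext e
    simp [ht, le_div_iff₀ hs, le_sub_iff_add_le', mul_comm]
  · simp [ht]

lemma integrable_stdNormalCDF_comp (x ρ s : ℝ) (S : Set ℝ) :
    IntegrableOn (fun t => stdNormalCDF ((x - ρ * t) / s)) S (gaussianReal 0 1) := by
  refine Integrable.of_bound (C := 1)
    (measurable_stdNormalCDF.comp (by fun_prop)).aestronglyMeasurable
    (Filter.Eventually.of_forall fun t => ?_)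
  rw [Real.norm_of_nonneg (stdNormalCDF_pos _).le]
  exact (stdNormalCDF_lt_one _).le

lemma stdBivariateNormalCDF_sub_eq_integral {ρ : ℝ} (hρ : ρ ∈ Set.Ioo (-1 : ℝ) 1) (x : ℝ)
    {y₀ y₁ : ℝ} (h : y₀ ≤ y₁) :
    stdBivariateNormalCDF x y₁ ρ - stdBivariateNormalCDF x y₀ ρ = ∫ t in Set.Ioc y₀ y₁,
      stdNormalCDF ((x - ρ * t) / √(1 - ρ ^ 2)) ∂(gaussianReal 0 1) := by
  rw [stdBivariateNormalCDF_eq_integral hρ, stdBivariateNormalCDF_eq_integral hρ,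
    ← Set.Iic_union_Ioc_eq_Iic h, setIntegral_union (Set.Iic_disjoint_Ioc le_rfl)
      measurableSet_Ioc (integrable_stdNormalCDF_comp ..) (integrable_stdNormalCDF_comp ..)]
  ring

lemma setIntegral_lt_setIntegral {α : Type*} [MeasurableSpace α] {μ : Measure α} {S : Set α}
    {f g : α → ℝ} (hS : MeasurableSet S) (hμ : μ S ≠ 0) (hf : IntegrableOn f S μ)
    (hg : IntegrableOn g S μ) (h : ∀ x ∈ S, f x < g x) :
    ∫ x in S, f x ∂μ < ∫ x in S, g x ∂μ := by
  rw [← sub_pos, ← integral_sub hg hf]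
  refine (setIntegral_pos_iff_support_of_nonneg_ae
    (ae_restrict_of_forall_mem hS fun x hx => (sub_pos.2 (h x hx)).le) (hg.sub hf)).2 ?_
  rw [Set.inter_eq_right.2 (show S ⊆ Function.support _ from fun x hx => (sub_pos.2 (h x hx)).ne')]
  exact pos_iff_ne_zero.2 hμ

lemma Iic_measure_ne_zero (y : ℝ) : gaussianReal 0 1 (Set.Iic y) ≠ 0 :=
  gaussianReal_ne_zero_of_Ioc_subset (sub_one_lt y) Set.Ioc_subset_Iic_self

lemma integral_stdNormalCDF_comp_mem_Ioo (x ρ s : ℝ) {S : Set ℝ} (hS : MeasurableSet S)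
    (h0 : gaussianReal 0 1 S ≠ 0) :
    ∫ t in S, stdNormalCDF ((x - ρ * t) / s) ∂(gaussianReal 0 1) ∈
      Set.Ioo 0 ((gaussianReal 0 1).real S) := by
  constructor
  · simpa using setIntegral_lt_setIntegral hS h0 (integrable_zero _ _ _).integrableOn
      (integrable_stdNormalCDF_comp x ρ s S) fun t _ => stdNormalCDF_pos _
  · simpa using setIntegral_lt_setIntegral hS h0 (integrable_stdNormalCDF_comp x ρ s S)
      (integrable_const 1).integrableOn fun t _ => stdNormalCDF_lt_one _

/-- For `|ρ| < 1`, a half-plane `W ≤ y` is split nontrivially by `X ≤ x`. -/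
lemma stdBivariateNormalCDF_mem_Ioo {ρ : ℝ} (hρ : ρ ∈ Set.Ioo (-1 : ℝ) 1) (x y : ℝ) :
    stdBivariateNormalCDF x y ρ ∈ Set.Ioo 0 (stdNormalCDF y) := by
  rw [stdBivariateNormalCDF_eq_integral hρ, stdNormalCDF_eq_real]
  exact integral_stdNormalCDF_comp_mem_Ioo _ _ _ measurableSet_Iic (Iic_measure_ne_zero y)

/-- For `|ρ| < 1` the probability of a strip `y₀ < W ≤ y₁` is split nontrivially by `X ≤ x`. -/
lemma stdBivariateNormalCDF_sub_mem_Ioo {ρ : ℝ} (hρ : ρ ∈ Set.Ioo (-1 : ℝ) 1) (x : ℝ)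
    {y₀ y₁ : ℝ} (h : y₀ < y₁) :
    stdBivariateNormalCDF x y₁ ρ - stdBivariateNormalCDF x y₀ ρ ∈
      Set.Ioo 0 (stdNormalCDF y₁ - stdNormalCDF y₀) := by
  rw [stdBivariateNormalCDF_sub_eq_integral hρ x h.le, stdNormalCDF_sub_eq_real h.le]
  exact integral_stdNormalCDF_comp_mem_Ioo _ _ _ measurableSet_Ioc
    (gaussianReal_ne_zero_of_Ioc_subset h subset_rfl)

/-- The slope `ρ / √(1 - ρ²)` of the conditional probit index is increasing in `ρ`, being
`tan (arcsin ρ)`. -/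
lemma strictMonoOn_div_sqrt :
    StrictMonoOn (fun ρ : ℝ => ρ / √(1 - ρ ^ 2)) (Set.Ioo (-1) 1) := fun a ha b hb hab => by
  simp only [← Real.tan_arcsin]
  exact Real.tan_lt_tan_of_lt_of_lt_pi_div_two (Real.neg_pi_div_two_lt_arcsin.2 ha.1)
    (Real.arcsin_lt_pi_div_two.2 hb.2) (Real.arcsin_lt_arcsin ha.1.le hab hb.2.le)

/-- Single crossing: two conditional probit indices with different correlations are lines of
different slopes, so the conditional distribution functions of the first coordinate cross
exactly once. If they agree on average over `W ≤ y₀`, the crossing lies to the left of `y₀`, and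
they cannot agree on average over `y₀ < W ≤ y₁`. -/
lemma not_lt_of_stdBivariateNormalCDF_eq {x x' ρ ρ' y₀ y₁ : ℝ} (hρ : ρ ∈ Set.Ioo (-1 : ℝ) 1)
    (hρ' : ρ' ∈ Set.Ioo (-1 : ℝ) 1) (hy : y₀ < y₁)
    (h₀ : stdBivariateNormalCDF x y₀ ρ = stdBivariateNormalCDF x' y₀ ρ')
    (h₁ : stdBivariateNormalCDF x y₁ ρ = stdBivariateNormalCDF x' y₁ ρ') : ¬ ρ < ρ' := by
  intro hlt
  have hb := strictMonoOn_div_sqrt hρ hρ' hlt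
  have hd := stdBivariateNormalCDF_sub_eq_integral hρ x hy.le
  rw [h₀, h₁, stdBivariateNormalCDF_sub_eq_integral hρ' x' hy.le] at hd
  rw [stdBivariateNormalCDF_eq_integral hρ, stdBivariateNormalCDF_eq_integral hρ'] at h₀
  set s := √(1 - ρ ^ 2)
  set s' := √(1 - ρ' ^ 2)
  have e : ∀ t, (x - ρ * t) / s - (x' - ρ' * t) / s' =
      (ρ' / s' - ρ / s) * t - (x' / s' - x / s) := fun t => by ring
  have hb' : 0 < ρ' / s' - ρ / s := sub_pos.2 hb
  -- The lines cross at `t = (x' / s' - x / s) / (ρ' / s' - ρ / s)`; compare this with `y₀`.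
  rcases le_or_gt (x' / s' - x / s) ((ρ' / s' - ρ / s) * y₀) with hc | hc
  · refine hd.not_lt (setIntegral_lt_setIntegral measurableSet_Ioc
      (gaussianReal_ne_zero_of_Ioc_subset hy subset_rfl) (integrable_stdNormalCDF_comp ..)
      (integrable_stdNormalCDF_comp ..) fun t ht => stdNormalCDF_strictMono ?_)
    have := mul_lt_mul_of_pos_left ht.1 hb'
    linarith [e t]
  · refine h₀.not_lt (setIntegral_lt_setIntegral measurableSet_Iic (Iic_measure_ne_zero y₀)
      (integrable_stdNormalCDF_comp ..)
      (integrable_stdNormalCDF_comp ..) fun t ht => stdNormalCDF_strictMono ?_)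
    have := mul_le_mul_of_nonneg_left (Set.mem_Iic.1 ht) hb'.le
    linarith [e t]

lemma stdBivariateNormalCDF_strictMono_left {ρ : ℝ} (hρ : ρ ∈ Set.Ioo (-1 : ℝ) 1) (y : ℝ) :
    StrictMono fun x => stdBivariateNormalCDF x y ρ := fun x x' h => by
  have hs : 0 < √(1 - ρ ^ 2) := Real.sqrt_pos.2 (by nlinarith [hρ.1, hρ.2])
  simp only [stdBivariateNormalCDF_eq_integral hρ]
  refine setIntegral_lt_setIntegral measurableSet_Iic (Iic_measure_ne_zero y)
    (integrable_stdNormalCDF_comp ..) (integrable_stdNormalCDF_comp ..)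
    fun t _ => stdNormalCDF_strictMono ?_
  gcongr

/-- Two values of `Φ₂(x, ·; ρ)` determine `(x, ρ)` when `|ρ| < 1`. -/
lemma eq_of_stdBivariateNormalCDF_eq {x x' ρ ρ' y₀ y₁ : ℝ} (hρ : ρ ∈ Set.Ioo (-1 : ℝ) 1)
    (hρ' : ρ' ∈ Set.Ioo (-1 : ℝ) 1) (hy : y₀ < y₁)
    (h₀ : stdBivariateNormalCDF x y₀ ρ = stdBivariateNormalCDF x' y₀ ρ')
    (h₁ : stdBivariateNormalCDF x y₁ ρ = stdBivariateNormalCDF x' y₁ ρ') : x = x' ∧ ρ = ρ' := by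
  obtain rfl : ρ = ρ' := le_antisymm
    (not_lt.1 (not_lt_of_stdBivariateNormalCDF_eq hρ' hρ hy h₀.symm h₁.symm))
    (not_lt.1 (not_lt_of_stdBivariateNormalCDF_eq hρ hρ' hy h₀ h₁))
  exact ⟨(stdBivariateNormalCDF_strictMono_left hρ y₀).injective h₀, rfl⟩

/-- Fréchet bounds on `Φ₂` in terms of its marginals, for all correlations. -/
lemma stdNormalCDF_mem_Icc {ρ : ℝ} (hρ : ρ ∈ Set.Icc (-1 : ℝ) 1) (x y : ℝ) :
    stdNormalCDF x ∈ Set.Icc (stdBivariateNormalCDF x y ρ)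
      (stdBivariateNormalCDF x y ρ + (1 - stdNormalCDF y)) := by
  have key : ∀ (i : Fin 2) (c : ℝ), stdNormalCDF c =
      (multivariateGaussian (0 : EuclideanSpace ℝ (Fin 2)) !![1, ρ; ρ, 1]).real
        {v | v i ≤ c} := fun i c => by
    have h := measurePreserving_eval_multivariateGaussian (μ := 0) (posSemidef_corr hρ) (i := i)
    have h1 : gaussianReal ((0 : EuclideanSpace ℝ (Fin 2)) i)
        ((!![1, ρ; ρ, 1] : Matrix (Fin 2) (Fin 2) ℝ) i i).toNNReal = gaussianReal 0 1 := by
      fin_cases i <;> simp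
    rw [stdNormalCDF_eq_real, ← h1, ← h.measureReal_preimage measurableSet_Iic.nullMeasurableSet]
    rfl
  have hm : MeasurableSet {v : EuclideanSpace ℝ (Fin 2) | v 1 ≤ y} :=
    measurableSet_le (by fun_prop) measurable_const
  rw [key 0 x, key 1 y, ← probReal_compl_eq_one_sub hm]
  refine ⟨measureReal_mono fun v hv => hv.1,
    (measureReal_mono fun v hv => ?_).trans (measureReal_union_le _ _)⟩
  by_cases h : v 1 ≤ y
  · exact Or.inl ⟨hv, h⟩
  · exact Or.inr h

/-! ### Functionals of the law of the observables -/

section Observables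

lemma obsD_eq_one {Ω : Type*} {Dstar : Ω → ℝ} {ω : Ω} : obsD Dstar ω = 1 ↔ Dstar ω ≤ 0 := by
  simp [obsD]

lemma obsD_eq_zero {Ω : Type*} {Dstar : Ω → ℝ} {ω : Ω} : obsD Dstar ω = 0 ↔ 0 < Dstar ω := by
  simp [obsD]

variable {Ω : Type*} [MeasurableSpace Ω] {P : Measure Ω} {Ystar Dstar : Ω → ℝ} {Z : Ω → Fin 2}

lemma measurable_observables (hY : Measurable Ystar) (hD : Measurable Dstar) (hZ : Measurable Z) :
    Measurable fun ω => (obsY Ystar Dstar ω, obsD Dstar ω, Z ω) :=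
  (Measurable.ite (measurableSet_le hD measurable_const) hY.coe_real_ereal
    measurable_const).prodMk ((Measurable.ite (measurableSet_le hD measurable_const)
      measurable_const measurable_const).prodMk hZ)

lemma cond_map_real {α : Type*} [MeasurableSpace α] {f : Ω → α} (hf : Measurable f) {S T : Set α}
    (hS : MeasurableSet S) (hT : MeasurableSet T) :
    (ProbabilityTheory.cond (P.map f) S).real T =
      (ProbabilityTheory.cond P (f ⁻¹' S)).real (f ⁻¹' T) := by
  simp only [measureReal_def, cond_apply hS, cond_apply (hf hS), ← Set.preimage_inter]
  rw [Measure.map_apply hf hS, Measure.map_apply hf (hS.inter hT)]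

lemma obsLaw_real_selected (hY : Measurable Ystar) (hD : Measurable Dstar) (hZ : Measurable Z) :
    (obsLaw P Ystar Dstar Z).real {a | a.2.1 = 1} = P.real {ω | obsD Dstar ω = 1} :=
  map_measureReal_apply (measurable_observables hY hD hZ)
    ((measurable_fst.comp measurable_snd) (measurableSet_singleton 1))

lemma cond_obsLaw_selected (hY : Measurable Ystar) (hD : Measurable Dstar) (hZ : Measurable Z) :
    (ProbabilityTheory.cond (obsLaw P Ystar Dstar Z) {a | a.2.1 = 1}).real {a | a.2.2 = 1} =
      (ProbabilityTheory.cond P {ω | obsD Dstar ω = 1}).real {ω | Z ω = 1} :=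
  cond_map_real (measurable_observables hY hD hZ)
    ((measurable_fst.comp measurable_snd) (measurableSet_singleton 1))
    ((measurable_snd.comp measurable_snd) (measurableSet_singleton 1))

lemma cond_obsLaw_obsD (hY : Measurable Ystar) (hD : Measurable Dstar) (hZ : Measurable Z)
    (d z : Fin 2) :
    (ProbabilityTheory.cond (obsLaw P Ystar Dstar Z) {a | a.2.2 = z}).real {a | a.2.1 = d} =
      probD P Dstar Z d z :=
  cond_map_real (measurable_observables hY hD hZ)
    ((measurable_snd.comp measurable_snd) (measurableSet_singleton z))
    ((measurable_fst.comp measurable_snd) (measurableSet_singleton d))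

lemma cond_obsLaw_Iic (hY : Measurable Ystar) (hD : Measurable Dstar) (hZ : Measurable Z)
    (y : ℝ) (d z : Fin 2) :
    (ProbabilityTheory.cond (obsLaw P Ystar Dstar Z) {a | a.2.2 = z}).real
      {a | a.1 ≤ (y : EReal) ∧ a.2.1 ≤ d} = obsCDF P Ystar Dstar Z y d z :=
  cond_map_real (measurable_observables hY hD hZ)
    ((measurable_snd.comp measurable_snd) (measurableSet_singleton z))
    (MeasurableSet.inter (s₁ := {a : EReal × Fin 2 × Fin 2 | a.1 ≤ (y : EReal)})
      (s₂ := {a | a.2.1 ≤ d}) (measurable_fst measurableSet_Iic)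
      ((measurable_fst.comp measurable_snd) (Set.Iic d).toFinite.measurableSet))

section Congr

variable {Ω' : Type*} [MeasurableSpace Ω'] {Q : Measure Ω'} {Ystar' Dstar' : Ω' → ℝ}
  {Z' : Ω' → Fin 2}

lemma solutionSet_congr (hY : Measurable Ystar) (hD : Measurable Dstar) (hZ : Measurable Z)
    (hY' : Measurable Ystar') (hD' : Measurable Dstar') (hZ' : Measurable Z')
    (h : obsLaw Q Ystar' Dstar' Z' = obsLaw P Ystar Dstar Z) (y : ℝ) :
    solutionSet Q Ystar' Dstar' Z' y = solutionSet P Ystar Dstar Z y := by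
  simp only [solutionSet, ← cond_obsLaw_obsD hY hD hZ, ← cond_obsLaw_Iic hY hD hZ,
    ← cond_obsLaw_obsD hY' hD' hZ', ← cond_obsLaw_Iic hY' hD' hZ', h]

/-- Non-degeneracy and relevance concern the law of the observables only, so they carry over to
every model generating that law. -/
lemma ExclusionRestrictions.of_obsLaw_eq {y μ ρ μ' ρ' : ℝ} {ν ν' : Fin 2 → ℝ}
    (hER : ExclusionRestrictions P Ystar Dstar Z y μ ρ ν)
    (hY : Measurable Ystar) (hD : Measurable Dstar) (hZ : Measurable Z)
    (hY' : Measurable Ystar') (hD' : Measurable Dstar') (hZ' : Measurable Z')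
    (h : obsLaw Q Ystar' Dstar' Z' = obsLaw P Ystar Dstar Z)
    (hL : ∀ z, IsLGR (condZ Q Z' z) Ystar' Dstar' y 0 μ' (ν' z) ρ') :
    ExclusionRestrictions Q Ystar' Dstar' Z' y μ' ρ' ν' where
  selection_nondegenerate := by
    rw [← obsLaw_real_selected hY' hD' hZ', h, obsLaw_real_selected hY hD hZ]
    exact hER.selection_nondegenerate
  instrument_nondegenerate := by
    rw [← cond_obsLaw_selected hY' hD' hZ', h, cond_obsLaw_selected hY hD hZ]
    exact hER.instrument_nondegenerate
  relevance := by
    simp only [← cond_obsLaw_obsD hY' hD' hZ', h]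
    simpa only [cond_obsLaw_obsD hY hD hZ] using hER.relevance
  relevance_lt_one := by
    rw [← cond_obsLaw_obsD hY' hD' hZ', h, cond_obsLaw_obsD hY hD hZ]
    exact hER.relevance_lt_one
  exclusion := hL

end Congr

/-- A local Gaussian representation exists only under a nonzero measure, since `0 < Φ`; so the
exclusion restrictions force `P(Z = z) > 0`. -/
lemma IsLGR.isProbabilityMeasure_condZ {y d μ ν ρ : ℝ} {z : Fin 2}
    (h : IsLGR (condZ P Z z) Ystar Dstar y d μ ν ρ) : IsProbabilityMeasure (condZ P Z z) := by
  have h0 : condZ P Z z ≠ 0 := fun h0 => by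
    have := h.marginal_fst
    rw [h0] at this
    exact (stdNormalCDF_pos μ).ne (by simpa using this)
  have h1 := mt ProbabilityTheory.cond_eq_zero.2 h0
  rw [not_or] at h1
  exact cond_isProbabilityMeasure_of_finite h1.2 h1.1

lemma IsLGR.probD_one {y μ ν ρ : ℝ} {z : Fin 2}
    (h : IsLGR (condZ P Z z) Ystar Dstar y 0 μ ν ρ) : probD P Dstar Z 1 z = stdNormalCDF ν := by
  rw [← h.marginal_snd]
  simp only [probD, obsD_eq_one]

lemma probD_zero (hD : Measurable Dstar) {z : Fin 2} [IsProbabilityMeasure (condZ P Z z)] :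
    probD P Dstar Z 0 z = 1 - probD P Dstar Z 1 z := by
  simp only [probD, obsD_eq_one, obsD_eq_zero]
  rw [← probReal_compl_eq_one_sub (measurableSet_le hD measurable_const)]
  congr 1
  ext ω
  simp

lemma obsCDF_sub_probD_zero (hD : Measurable Dstar) {z : Fin 2}
    [IsProbabilityMeasure (condZ P Z z)] (y : ℝ) :
    obsCDF P Ystar Dstar Z y 1 z - probD P Dstar Z 0 z =
      (condZ P Z z).real {ω | Ystar ω ≤ y ∧ Dstar ω ≤ 0} := by
  have hu : {ω | obsY Ystar Dstar ω ≤ (y : EReal) ∧ obsD Dstar ω ≤ 1} =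
      {ω | Ystar ω ≤ y ∧ Dstar ω ≤ 0} ∪ {ω | 0 < Dstar ω} := by
    ext ω
    by_cases h : Dstar ω ≤ 0
    · simp [obsY, obsD, h, h.not_gt]
    · simp [obsY, obsD, h, not_le.1 h]
  have hd : Disjoint {ω | Ystar ω ≤ y ∧ Dstar ω ≤ 0} {ω | 0 < Dstar ω} :=
    Set.disjoint_left.2 fun ω h h' => h.2.not_gt h'
  simp only [obsCDF, probD, obsD_eq_zero]
  rw [hu, measureReal_union hd (measurableSet_lt measurable_const hD), add_sub_cancel_right]

/-- The exclusion restrictions turn the joint part of the local Gaussian representations into the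
system of equations. -/
lemma ExclusionRestrictions.mem_solutionSet {y μ ρ : ℝ} {ν : Fin 2 → ℝ} (hD : Measurable Dstar)
    (hER : ExclusionRestrictions P Ystar Dstar Z y μ ρ ν) :
    (μ, ρ) ∈ solutionSet P Ystar Dstar Z y := by
  refine ⟨(hER.exclusion 0).corr_mem, fun z => ?_⟩
  have hz := hER.exclusion z
  have := hz.isProbabilityMeasure_condZ
  rw [obsCDF_sub_probD_zero hD, hz.probD_one, probit_stdNormalCDF, hz.joint]

/-! ### The identified set -/

/-- The law of a latent model that agrees with `(Y*, D*, Z)` on the selected part `D* ≤ 0` and in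
which, given `Z = z` and `D* > 0`, the unobserved outcome is `y` with probability `c z` and
`y + 1` otherwise. The randomization is by an independent uniform variable. -/
noncomputable def redrawnLaw (P : Measure Ω) (Ystar Dstar : Ω → ℝ) (Z : Ω → Fin 2) (y : ℝ)
    (c : Fin 2 → ℝ) : Measure (ℝ × ℝ × Fin 2) :=
  (P.prod (volume.restrict (Set.Icc (0 : ℝ) 1))).map fun a =>
    (if Dstar a.1 ≤ 0 then Ystar a.1 else if a.2 ≤ c (Z a.1) then y else y + 1, Dstar a.1, Z a.1)

instance : IsProbabilityMeasure (volume.restrict (Set.Icc (0 : ℝ) 1)) := ⟨by simp⟩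

variable {y : ℝ} {c : Fin 2 → ℝ}

lemma measurable_redrawn (hY : Measurable Ystar) (hD : Measurable Dstar) (hZ : Measurable Z) :
    Measurable fun a : Ω × ℝ =>
      (if Dstar a.1 ≤ 0 then Ystar a.1 else if a.2 ≤ c (Z a.1) then y else y + 1,
        Dstar a.1, Z a.1) := by
  have hc : Measurable fun a : Ω × ℝ => c (Z a.1) :=
    (measurable_of_finite c).comp (hZ.comp measurable_fst)
  exact (Measurable.ite (measurableSet_le (hD.comp measurable_fst) measurable_const)
    (hY.comp measurable_fst) (Measurable.ite (measurableSet_le measurable_snd hc)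
      measurable_const measurable_const)).prodMk
    ((hD.comp measurable_fst).prodMk (hZ.comp measurable_fst))

lemma obsLaw_redrawnLaw [IsProbabilityMeasure P] (hY : Measurable Ystar) (hD : Measurable Dstar)
    (hZ : Measurable Z) :
    obsLaw (redrawnLaw P Ystar Dstar Z y c) (fun q => q.1) (fun q => q.2.1) (fun q => q.2.2) =
      obsLaw P Ystar Dstar Z := by
  have hobs := measurable_observables hY hD hZ
  have hobs' := measurable_observables (Ω := ℝ × ℝ × Fin 2) measurable_fst
    (measurable_fst.comp measurable_snd) (measurable_snd.comp measurable_snd)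
  have hfst := (measurePreserving_fst (μ := P) (ν := volume.restrict (Set.Icc (0 : ℝ) 1))).map_eq
  refine (Measure.map_map hobs' (measurable_redrawn hY hD hZ)).trans ?_
  conv_rhs => rw [obsLaw, ← hfst, Measure.map_map hobs measurable_fst]
  congr 1
  ext a
  · by_cases h : Dstar a.1 ≤ 0 <;> simp [obsY, h]
  · rfl
  · rfl

lemma redrawnLaw_unselected [IsProbabilityMeasure P] (hY : Measurable Ystar)
    (hD : Measurable Dstar) (hZ : Measurable Z) {z : Fin 2} (hc : c z ∈ Set.Icc (0 : ℝ) 1) :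
    (condZ (redrawnLaw P Ystar Dstar Z y c) (fun q => q.2.2) z).real
      {q | q.1 ≤ y ∧ 0 < q.2.1} = c z * probD P Dstar Z 0 z := by
  have hg := measurable_redrawn (y := y) (c := c) hY hD hZ
  have hS : MeasurableSet ((fun q : ℝ × ℝ × Fin 2 => q.2.2) ⁻¹' {z}) :=
    (measurable_snd.comp measurable_snd) (measurableSet_singleton z)
  have hT : MeasurableSet {q : ℝ × ℝ × Fin 2 | q.1 ≤ y ∧ 0 < q.2.1} :=
    MeasurableSet.inter (s₁ := {q : ℝ × ℝ × Fin 2 | q.1 ≤ y}) (s₂ := {q | 0 < q.2.1})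
      (measurableSet_le measurable_fst measurable_const)
      (measurableSet_lt measurable_const (measurable_fst.comp measurable_snd))
  have hu : (volume.restrict (Set.Icc (0 : ℝ) 1)).real (Set.Iic (c z)) = c z := by
    rw [measureReal_restrict_apply measurableSet_Iic, Set.inter_comm, ← Set.Ici_inter_Iic,
      Set.inter_assoc, Set.Iic_inter_Iic, min_eq_right hc.2, Set.Ici_inter_Iic,
      Real.volume_real_Icc_of_le hc.1, sub_zero]
  rw [condZ, redrawnLaw, cond_map_real hg hS hT, probD, condZ, measureReal_def, measureReal_def,
    cond_apply (hg hS), cond_apply (hZ (measurableSet_singleton z)), ENNReal.toReal_mul,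
    ENNReal.toReal_mul, ← measureReal_def (P.prod _), ← measureReal_def P]
  have e1 : (fun a : Ω × ℝ => (if Dstar a.1 ≤ 0 then Ystar a.1 else
      if a.2 ≤ c (Z a.1) then y else y + 1, Dstar a.1, Z a.1)) ⁻¹'
        ((fun q : ℝ × ℝ × Fin 2 => q.2.2) ⁻¹' {z}) = (Z ⁻¹' {z}) ×ˢ Set.univ := by
    ext a; simp
  have e2 : (Z ⁻¹' {z}) ×ˢ Set.univ ∩ (fun a : Ω × ℝ => (if Dstar a.1 ≤ 0 then Ystar a.1 else
      if a.2 ≤ c (Z a.1) then y else y + 1, Dstar a.1, Z a.1)) ⁻¹'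
        {q : ℝ × ℝ × Fin 2 | q.1 ≤ y ∧ 0 < q.2.1} =
      (Z ⁻¹' {z} ∩ {ω | obsD Dstar ω = 0}) ×ˢ Set.Iic (c z) := by
    ext a
    simp only [Set.mem_inter_iff, Set.mem_prod, Set.mem_preimage, Set.mem_singleton_iff,
      Set.mem_univ, and_true, Set.mem_ofPred_eq, obsD_eq_zero, Set.mem_Iic]
    constructor
    · rintro ⟨rfl, h, hd⟩
      by_cases hc' : a.2 ≤ c (Z a.1)
      · exact ⟨⟨rfl, hd⟩, hc'⟩
      · simp only [hd.not_ge, hc', if_false] at h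
        linarith
    · rintro ⟨⟨rfl, hd⟩, h⟩
      simp [hd.not_ge, h, hd]
  rw [e1, e2, measureReal_prod_prod, hu, Measure.prod_prod, measure_univ, mul_one]
  ring

/-- Every solution of the system is generated by a latent model: keep the law of the observables
and redraw the unobserved outcomes so that `P(Y* ≤ y | Z = z) = Φ(μ)`, which the Fréchet bounds
on `Φ₂` make possible. Conversely every latent model yields a solution. -/
lemma ExclusionRestrictions.identifiedSet_eq_solutionSet [IsProbabilityMeasure P] {μ ρ : ℝ}
    {ν : Fin 2 → ℝ} (hER : ExclusionRestrictions P Ystar Dstar Z y μ ρ ν)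
    (hY : Measurable Ystar) (hD : Measurable Dstar) (hZ : Measurable Z) :
    identifiedSet (obsLaw P Ystar Dstar Z) y = solutionSet P Ystar Dstar Z y := by
  have hY' : Measurable fun q : ℝ × ℝ × Fin 2 => q.1 := measurable_fst
  have hD' : Measurable fun q : ℝ × ℝ × Fin 2 => q.2.1 := measurable_fst.comp measurable_snd
  have hZ' : Measurable fun q : ℝ × ℝ × Fin 2 => q.2.2 := measurable_snd.comp measurable_snd
  ext θ
  constructor
  · rintro ⟨Q, -, ⟨ν', hQ⟩, hL⟩
    rw [← solutionSet_congr hY hD hZ hY' hD' hZ' hL]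
    exact hQ.mem_solutionSet hD'
  · rintro ⟨hθ, hsys⟩
    have hP := fun z => (hER.exclusion z).isProbabilityMeasure_condZ
    have hp := fun z => (hER.exclusion z).probD_one
    have hq : ∀ z, probD P Dstar Z 0 z = 1 - stdNormalCDF (ν z) := fun z => by
      rw [probD_zero hD, hp]
    have hq0 : ∀ z, 0 < probD P Dstar Z 0 z := fun z => by
      rw [hq]; exact sub_pos.2 (stdNormalCDF_lt_one _)
    simp only [hp, probit_stdNormalCDF] at hsys
    have hF := fun z => stdNormalCDF_mem_Icc hθ θ.1 (ν z)
    let c : Fin 2 → ℝ := fun z =>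
      (stdNormalCDF θ.1 - stdBivariateNormalCDF θ.1 (ν z) θ.2) / probD P Dstar Z 0 z
    have hc : ∀ z, c z ∈ Set.Icc (0 : ℝ) 1 := fun z =>
      ⟨div_nonneg (sub_nonneg.2 (hF z).1) (hq0 z).le,
        (div_le_one (hq0 z)).2 (by rw [hq]; linarith [(hF z).2])⟩
    have hL := obsLaw_redrawnLaw (P := P) (y := y) (c := c) hY hD hZ
    have hQ : IsProbabilityMeasure (redrawnLaw P Ystar Dstar Z y c) :=
      Measure.isProbabilityMeasure_map (measurable_redrawn hY hD hZ).aemeasurable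
    refine ⟨redrawnLaw P Ystar Dstar Z y c, hQ, ⟨ν, hER.of_obsLaw_eq hY hD hZ hY' hD' hZ' hL
      fun z => ?_⟩, hL⟩
    have hpQ : ∀ d, probD (redrawnLaw P Ystar Dstar Z y c) (fun q => q.2.1) (fun q => q.2.2) d z =
        probD P Dstar Z d z := fun d => by
      rw [← cond_obsLaw_obsD hY' hD' hZ', hL, cond_obsLaw_obsD hY hD hZ]
    have hPQ : IsProbabilityMeasure (condZ (redrawnLaw P Ystar Dstar Z y c)
        (fun q => q.2.2) z) := by
      refine cond_isProbabilityMeasure fun h0 => (hq0 z).ne' ?_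
      rw [← hpQ 0, probD, condZ, cond_eq_zero_of_meas_eq_zero h0]
      simp
    have hjoint : (condZ (redrawnLaw P Ystar Dstar Z y c) (fun q => q.2.2) z).real
        {q | q.1 ≤ y ∧ q.2.1 ≤ 0} = stdBivariateNormalCDF θ.1 (ν z) θ.2 := by
      rw [← obsCDF_sub_probD_zero hD', hpQ, ← cond_obsLaw_Iic hY' hD' hZ', hL,
        cond_obsLaw_Iic hY hD hZ, hsys]
    refine ⟨?_, ?_, hθ, hjoint⟩
    · have hsplit : {q : ℝ × ℝ × Fin 2 | q.1 ≤ y} =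
          {q | q.1 ≤ y ∧ q.2.1 ≤ 0} ∪ {q | q.1 ≤ y ∧ 0 < q.2.1} := by
        ext q
        simp [← and_or_left, le_or_gt]
      have hms : MeasurableSet {q : ℝ × ℝ × Fin 2 | q.1 ≤ y ∧ 0 < q.2.1} :=
        MeasurableSet.inter (s₁ := {q : ℝ × ℝ × Fin 2 | q.1 ≤ y}) (s₂ := {q | 0 < q.2.1})
          (measurableSet_le hY' measurable_const) (measurableSet_lt measurable_const hD')
      rw [hsplit, measureReal_union (Set.disjoint_left.2 fun q h h' => h.2.not_gt h'.2) hms, hjoint,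
        redrawnLaw_unselected hY hD hZ (hc z), div_mul_cancel₀ _ (hq0 z).ne',
        add_sub_cancel]
    · rw [← hp, ← hpQ 1]
      simp only [probD, obsD_eq_one]

end Observables

/-! ### Classification of solutions by their correlation -/

/-- For `|ρ| < 1`, both the half-plane `W ≤ y₀` and the strip `y₀ < W ≤ y₁` are split nontrivially by
`X ≤ x`; for `ρ = 1` and `ρ = -1`, `Φ₂` attains the upper and the lower Fréchet bound. -/
lemma stdBivariateNormalCDF_trichotomy {ρ : ℝ} (hρ : ρ ∈ Set.Icc (-1 : ℝ) 1) (x : ℝ) {y₀ y₁ : ℝ}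
    (hy : y₀ < y₁) :
    (ρ ∈ Set.Ioo (-1 : ℝ) 1 ∧
      stdBivariateNormalCDF x y₀ ρ ∈ Set.Ioo 0 (stdNormalCDF y₀) ∧
      stdBivariateNormalCDF x y₁ ρ - stdBivariateNormalCDF x y₀ ρ ∈
        Set.Ioo 0 (stdNormalCDF y₁ - stdNormalCDF y₀)) ∨
    (ρ = 1 ∧ ∀ y, stdBivariateNormalCDF x y ρ = min (stdNormalCDF x) (stdNormalCDF y)) ∨
    (ρ = -1 ∧ ∀ y, stdBivariateNormalCDF x y ρ = max (stdNormalCDF x + stdNormalCDF y - 1) 0) := by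
  rcases hρ.1.eq_or_lt with rfl | h1
  · exact Or.inr (Or.inr ⟨rfl, stdBivariateNormalCDF_neg_one x⟩)
  rcases hρ.2.eq_or_lt with rfl | h2
  · exact Or.inr (Or.inl ⟨rfl, fun y => (stdBivariateNormalCDF_one x y).trans
      (stdNormalCDF_strictMono.monotone.map_min)⟩)
  exact Or.inl ⟨⟨h1, h2⟩, stdBivariateNormalCDF_mem_Ioo ⟨h1, h2⟩ x y₀,
    stdBivariateNormalCDF_sub_mem_Ioo ⟨h1, h2⟩ x hy⟩

end SampleSelection

open SampleSelection

theorem theorem1 {Ω : Type*} [MeasurableSpace Ω] (P : Measure Ω) [IsProbabilityMeasure P]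
    (Ystar Dstar : Ω → ℝ) (Z : Ω → Fin 2)
    (hY : Measurable Ystar) (hD : Measurable Dstar) (hZ : Measurable Z)
    (y μ ρ : ℝ) (ν : Fin 2 → ℝ)
    (hER : SampleSelection.ExclusionRestrictions P Ystar Dstar Z y μ ρ ν) :
    let Φinv : ℝ → ℝ := SampleSelection.probit
    -- `F z = F_{Y,D|Z}(y, 1 | z)`, `p z = P(D = 1 | Z = z)`, `q z = P(D = 0 | Z = z)`
    let F : Fin 2 → ℝ := fun z => SampleSelection.obsCDF P Ystar Dstar Z y 1 z
    let p : Fin 2 → ℝ := fun z => SampleSelection.probD P Dstar Z 1 z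
    let q : Fin 2 → ℝ := fun z => SampleSelection.probD P Dstar Z 0 z
    let idSet : Set (ℝ × ℝ) :=
      SampleSelection.identifiedSet (SampleSelection.obsLaw P Ystar Dstar Z) y
    let sols : Set (ℝ × ℝ) := SampleSelection.solutionSet P Ystar Dstar Z y
    let case1 : Prop := F 1 - q 1 = F 0 - q 0 ∧ 0 < F 0 - q 0
    let case2 : Prop := F 1 < 1 ∧ F 0 = 1
    let case3 : Prop := F 1 = F 0 ∧ F 0 = 1
    let case4 : Prop := q 1 < F 1 ∧ F 0 = q 0
    let case5 : Prop := F 1 = F 0 ∧ F 0 < 1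
    let case6 : Prop := ∀ z, F z = q z
    (∀ z, ν z = Φinv (p z)) ∧
    (case1 → (ρ = 1 ∧ μ = Φinv (F 1 - q 1)) ∧ idSet = {(Φinv (F 1 - q 1), 1)}) ∧
    (case2 → (ρ = 1 ∧ μ = Φinv (F 1 - q 1)) ∧ idSet = {(Φinv (F 1 - q 1), 1)}) ∧
    (case3 → (ρ = 1 ∧ μ ∈ Set.Ici (Φinv (p 1))) ∧
      idSet = Set.Ici (Φinv (p 1)) ×ˢ {(1 : ℝ)}) ∧
    (case4 → (ρ = -1 ∧ μ = Φinv (F 1)) ∧ idSet = {(Φinv (F 1), -1)}) ∧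
    (case5 → (ρ = -1 ∧ μ = Φinv (F 1)) ∧ idSet = {(Φinv (F 1), -1)}) ∧
    (case6 → (ρ = -1 ∧ μ ∈ Set.Iic (Φinv (F 1))) ∧
      idSet = Set.Iic (Φinv (F 1)) ×ˢ {(-1 : ℝ)}) ∧
    (¬ case1 ∧ ¬ case2 ∧ ¬ case3 ∧ ¬ case4 ∧ ¬ case5 ∧ ¬ case6 →
      (∃! θ : ℝ × ℝ, θ ∈ sols) ∧ (μ, ρ) ∈ sols ∧ ρ ∈ Set.Ioo (-1 : ℝ) 1 ∧
      idSet = {(μ, ρ)}) := by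
  intro Φinv F p q idSet sols case1 case2 case3 case4 case5 case6
  have hP := fun z => (hER.exclusion z).isProbabilityMeasure_condZ
  have hp : ∀ z, p z = stdNormalCDF (ν z) := fun z => (hER.exclusion z).probD_one
  have hν : ∀ z, ν z = Φinv (p z) := fun z => by
    rw [hp]; exact (probit_stdNormalCDF _).symm
  have hq : ∀ z, q z = 1 - stdNormalCDF (ν z) := fun z => by
    rw [← hp]; exact probD_zero hD
  have hν01 : ν 0 < ν 1 := stdNormalCDF_strictMono.lt_iff_lt.1 (by
    rw [← hp, ← hp]; exact hER.relevance)
  have hΦ01 := stdNormalCDF_strictMono hν01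
  have hpos := fun z => stdNormalCDF_pos (ν z)
  have hlt := fun z => stdNormalCDF_lt_one (ν z)
  have hid : idSet = sols := hER.identifiedSet_eq_solutionSet hY hD hZ
  have hmem : (μ, ρ) ∈ sols := hER.mem_solutionSet hD
  have hsols : ∀ θ : ℝ × ℝ, θ ∈ sols ↔ θ.2 ∈ Set.Icc (-1 : ℝ) 1 ∧
      ∀ z, F z - q z = stdBivariateNormalCDF θ.1 (ν z) θ.2 := fun θ => by
    simp only [hν]; exact Iff.rfl
  -- `Φ₂` at a solution equals `F z - q z`; this rewrites the trichotomy in terms of the data.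
  have tri : ∀ θ ∈ sols,
      (θ.2 ∈ Set.Ioo (-1 : ℝ) 1 ∧ F 0 - q 0 ∈ Set.Ioo 0 (stdNormalCDF (ν 0)) ∧
        F 1 - q 1 - (F 0 - q 0) ∈ Set.Ioo 0 (stdNormalCDF (ν 1) - stdNormalCDF (ν 0))) ∨
      (θ.2 = 1 ∧ ∀ z, F z - q z = min (stdNormalCDF θ.1) (stdNormalCDF (ν z))) ∨
      (θ.2 = -1 ∧ ∀ z, F z - q z = max (stdNormalCDF θ.1 + stdNormalCDF (ν z) - 1) 0) :=
    fun θ hθ => by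
      obtain ⟨h, hs⟩ := (hsols θ).1 hθ
      simp only [hs]
      rcases stdBivariateNormalCDF_trichotomy h θ.1 hν01 with h | h | h
      · exact Or.inl h
      · exact Or.inr (Or.inl ⟨h.1, fun z => h.2 _⟩)
      · exact Or.inr (Or.inr ⟨h.1, fun z => h.2 _⟩)
  -- `Φ` is injective, so a solution set on which `Φ(μ)` and `ρ` are constant is a single point.
  have point : ∀ x r : ℝ, (∀ θ ∈ sols, θ.2 = r ∧ stdNormalCDF θ.1 = x) →
      (ρ = r ∧ μ = Φinv x) ∧ idSet = {(Φinv x, r)} := fun x r h => by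
    have h' : ∀ θ ∈ sols, θ = (Φinv x, r) := fun θ hθ => by
      refine Prod.ext ?_ (h θ hθ).1
      rw [← (h θ hθ).2]; exact (probit_stdNormalCDF _).symm
    have hμρ := h' _ hmem
    refine ⟨⟨congrArg Prod.snd hμρ, congrArg Prod.fst hμρ⟩, ?_⟩
    rw [hid, ← hμρ]
    exact Set.Subset.antisymm (fun θ hθ => (h' θ hθ).trans hμρ.symm) (by simpa using hmem)
  have hq0 := hq 0
  have hq1 := hq 1
  have hpos0 := hpos 0
  have hlt1 := hlt 1
  refine ⟨hν, fun h => point _ _ ?_, fun h => point _ _ ?_, fun h => ?_, fun h => point _ _ ?_,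
    fun h => point _ _ ?_, fun h => ?_, fun h => ?_⟩
  · rintro θ hθ
    rcases tri θ hθ with ⟨-, h0, h1⟩ | ⟨hr, h0⟩ | ⟨hr, h0⟩
    · exact absurd h1.1 (by linarith [h.1])
    · refine ⟨hr, ?_⟩
      have e0 := h0 0
      have e1 := h0 1
      rcases min_cases (stdNormalCDF θ.1) (stdNormalCDF (ν 0)) with c0 | c0 <;>
      rcases min_cases (stdNormalCDF θ.1) (stdNormalCDF (ν 1)) with c1 | c1 <;>
      linarith [h.1, h.2]
    · exfalso
      have e0 := h0 0
      have e1 := h0 1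
      rcases max_cases (stdNormalCDF θ.1 + stdNormalCDF (ν 0) - 1) 0 with c0 | c0 <;>
      rcases max_cases (stdNormalCDF θ.1 + stdNormalCDF (ν 1) - 1) 0 with c1 | c1 <;>
      linarith [h.1, h.2]
  · rintro θ hθ
    have hx := stdNormalCDF_lt_one θ.1
    rcases tri θ hθ with ⟨-, h0, h1⟩ | ⟨hr, h0⟩ | ⟨hr, h0⟩
    · exact absurd h0.2 (by linarith [h.2])
    · refine ⟨hr, ?_⟩
      have e1 := h0 1
      rcases min_cases (stdNormalCDF θ.1) (stdNormalCDF (ν 1)) with c1 | c1 <;>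
      linarith [h.1, h.2]
    · exfalso
      have e0 := h0 0
      rcases max_cases (stdNormalCDF θ.1 + stdNormalCDF (ν 0) - 1) 0 with c0 | c0 <;>
      linarith [h.1, h.2]
  · have hset : sols = Set.Ici (Φinv (p 1)) ×ˢ {(1 : ℝ)} := by
      rw [← hν]
      ext θ
      constructor
      · intro hθ
        rcases tri θ hθ with ⟨-, h0, h1⟩ | ⟨hr, h0⟩ | ⟨hr, h0⟩
        · exact absurd h0.2 (by linarith [h.2])
        · refine ⟨stdNormalCDF_strictMono.le_iff_le.1 ?_, hr⟩
          rw [← min_eq_right_iff, ← h0 1]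
          linarith [h.1, h.2]
        · exfalso
          have e0 := h0 0
          have hx := stdNormalCDF_lt_one θ.1
          rcases max_cases (stdNormalCDF θ.1 + stdNormalCDF (ν 0) - 1) 0 with c0 | c0 <;>
          linarith [h.1, h.2]
      · rintro ⟨hθ, hr : θ.2 = 1⟩
        have hθ' : ∀ z, ν z ≤ θ.1 := Fin.forall_fin_two.2 ⟨hν01.le.trans hθ, hθ⟩
        refine (hsols θ).2 ⟨by rw [hr]; norm_num, fun z => ?_⟩
        rw [hr, stdBivariateNormalCDF_one, min_eq_right (hθ' z)]
        have hF : F z = 1 := by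
          revert z; exact Fin.forall_fin_two.2 ⟨h.2, h.1.trans h.2⟩
        rw [hF, hq]; ring
    rw [hid, hset]
    rw [hset] at hmem
    exact ⟨⟨hmem.2, hmem.1⟩, rfl⟩
  · rintro θ hθ
    have hx := stdNormalCDF_pos θ.1
    rcases tri θ hθ with ⟨-, h0, h1⟩ | ⟨hr, h0⟩ | ⟨hr, h0⟩
    · exact absurd h0.1 (by linarith [h.2])
    · exfalso
      have e0 := h0 0
      rcases min_cases (stdNormalCDF θ.1) (stdNormalCDF (ν 0)) with c0 | c0 <;>
      linarith [h.1, h.2]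
    · refine ⟨hr, ?_⟩
      have e1 := h0 1
      rcases max_cases (stdNormalCDF θ.1 + stdNormalCDF (ν 1) - 1) 0 with c1 | c1 <;>
      linarith [h.1, h.2]
  · rintro θ hθ
    rcases tri θ hθ with ⟨-, h0, h1⟩ | ⟨hr, h0⟩ | ⟨hr, h0⟩
    · exact absurd h1.2 (by linarith [h.1])
    · exfalso
      have e0 := h0 0
      have e1 := h0 1
      rcases min_cases (stdNormalCDF θ.1) (stdNormalCDF (ν 0)) with c0 | c0 <;>
      rcases min_cases (stdNormalCDF θ.1) (stdNormalCDF (ν 1)) with c1 | c1 <;>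
      linarith [h.1, h.2]
    · refine ⟨hr, ?_⟩
      have e0 := h0 0
      have e1 := h0 1
      rcases max_cases (stdNormalCDF θ.1 + stdNormalCDF (ν 0) - 1) 0 with c0 | c0 <;>
      rcases max_cases (stdNormalCDF θ.1 + stdNormalCDF (ν 1) - 1) 0 with c1 | c1 <;>
      linarith [h.1, h.2]
  · have h6 : ∀ z, F z = q z := h
    have hset : sols = Set.Iic (Φinv (F 1)) ×ˢ {(-1 : ℝ)} := by
      -- `F 1 = 1 - Φ (ν 1) = Φ (-ν 1)`
      have hF1 : Φinv (F 1) = -ν 1 := by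
        rw [h6, hq, ← stdNormalCDF_neg]; exact probit_stdNormalCDF _
      rw [hF1]
      ext θ
      constructor
      · intro hθ
        rcases tri θ hθ with ⟨-, h0, h1⟩ | ⟨hr, h0⟩ | ⟨hr, h0⟩
        · exact absurd h0.1 (by linarith [h6 0])
        · exfalso
          have e0 := h0 0
          have hx := stdNormalCDF_pos θ.1
          rcases min_cases (stdNormalCDF θ.1) (stdNormalCDF (ν 0)) with c0 | c0 <;>
          linarith [h6 0]
        · refine ⟨stdNormalCDF_strictMono.le_iff_le.1 ?_, hr⟩
          rw [stdNormalCDF_neg]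
          have e1 := (h0 1).ge
          linarith [(le_max_left _ _).trans e1, h6 1]
      · rintro ⟨hθ, hr : θ.2 = -1⟩
        have hθ' : ∀ z, θ.1 ≤ -ν z :=
          Fin.forall_fin_two.2 ⟨hθ.trans (neg_le_neg hν01.le), hθ⟩
        refine (hsols θ).2 ⟨by rw [hr]; norm_num, fun z => ?_⟩
        have := stdNormalCDF_strictMono.monotone (hθ' z)
        rw [stdNormalCDF_neg] at this
        rw [hr, stdBivariateNormalCDF_neg_one, max_eq_right (by linarith), h6, sub_self]
    rw [hid, hset]
    rw [hset] at hmem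
    exact ⟨⟨hmem.2, hmem.1⟩, rfl⟩
  · obtain ⟨n1, n2, n3, n4, n5, n6⟩ := h
    have hIoo : ∀ θ ∈ sols, θ.2 ∈ Set.Ioo (-1 : ℝ) 1 := fun θ hθ => by
      have hx := stdNormalCDF_pos θ.1
      have hx' := stdNormalCDF_lt_one θ.1
      rcases tri θ hθ with ⟨hr, -⟩ | ⟨hr, h0⟩ | ⟨hr, h0⟩
      · exact hr
      · exfalso
        have e0 := h0 0
        have e1 := h0 1
        rcases le_or_gt (stdNormalCDF θ.1) (stdNormalCDF (ν 0)) with c0 | c0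
        · rw [min_eq_left c0] at e0
          rw [min_eq_left (c0.trans hΦ01.le)] at e1
          exact n1 ⟨by linarith, by linarith⟩
        rw [min_eq_right c0.le] at e0
        rcases lt_or_ge (stdNormalCDF θ.1) (stdNormalCDF (ν 1)) with c1 | c1
        · rw [min_eq_left c1.le] at e1
          exact n2 ⟨by linarith, by linarith⟩
        · rw [min_eq_right c1] at e1
          exact n3 ⟨by linarith, by linarith⟩
      · exfalso
        have e0 := h0 0
        have e1 := h0 1
        rcases le_or_gt (stdNormalCDF θ.1 + stdNormalCDF (ν 1) - 1) 0 with c1 | c1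
        · rw [max_eq_right (by linarith)] at e0 e1
          exact n6 (Fin.forall_fin_two.2 ⟨by linarith, by linarith⟩)
        rw [max_eq_left c1.le] at e1
        rcases le_or_gt (stdNormalCDF θ.1 + stdNormalCDF (ν 0) - 1) 0 with c0 | c0
        · rw [max_eq_right c0] at e0
          exact n4 ⟨by linarith, by linarith⟩
        · rw [max_eq_left c0.le] at e0
          exact n5 ⟨by linarith, by linarith⟩
    have huniq : ∀ θ ∈ sols, θ = (μ, ρ) := fun θ hθ => by
      have hs := ((hsols θ).1 hθ).2
      have hs' := ((hsols _).1 hmem).2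
      obtain ⟨e1, e2⟩ := eq_of_stdBivariateNormalCDF_eq (hIoo θ hθ) (hIoo _ hmem) hν01
        ((hs 0).symm.trans (hs' 0)) ((hs 1).symm.trans (hs' 1))
      exact Prod.ext e1 e2
    refine ⟨⟨(μ, ρ), hmem, huniq⟩, hmem, hIoo _ hmem, ?_⟩
    rw [hid]
    exact Set.Subset.antisymm huniq (by simpa using hmem)
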